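/- **Setting.** Let $X$ be a metric space with distance $d$. A *semiflow* on $X$ is a jointly continuous map $[0,\infty)\times X\to X$, $(t,x)\mapsto\phi^t(x)$, with $\phi^0=\mathrm{id}$ and $\phi^{s+t}=\phi^s\circ\phi^t$. *Chains.* For a map $T:X\to X$ write $x\rightsquigarrow_T y$ if for every continuous $\varepsilon:X\to(0,\infty)$ there are $n\ge 1$ and points $x=x_0,\dots,x_n=y$ with $d(T(x_i),x_{i+1})<\varepsilon(T(x_i))$ for $0\le i<n$. For a semiflow write $x\rightsquigarrow_\phi y$ if for every continuous $\varepsilon:X\to(0,\infty)$ and every $\tau>0$ there are $n\ge1$, points $x=x_0,\dots,x_n=y$ and times $t_i\ge \tau$ with $d(\phi^{t_i}(x_i),x_{i+1})<\varepsilon(\phi^{t_i}(x_i))$ for $0\le i<n$. In both cases the chain recurrent set is $\mathcal R_C=\{x: x\rightsquigarrow x\}$, and its chain transitive components are the classes of the equivalence relation "$x\rightsquigarrow y$ and $y\rightsquigarrow x$" on $\mathcal R_C$. *Complete Lyapunov functions.* A complete Lyapunov function for the semiflow is a continuous $L:X\to[0,1]$ such that 1. for $x\in\mathcal R_C$ the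 function $t\mapsto L(\phi^t(x))$ is constant; for $x\notin\mathcal R_C$ it is nonincreasing, and strictly decreasing as long as the orbit is off $\mathcal R_C$: $L(\phi^t(x))<L(\phi^s(x))$ whenever $0\le s<t$ and $\phi^s(x)\notin\mathcal R_C$; 2. $L(\mathcal R_C)$ is nowhere dense in $[0,1]$; 3. for every $c\in L(\mathcal R_C)$ the set $L^{-1}(c)\cap\mathcal R_C$ is a chain transitive component of $\mathcal R_C$. For a continuous map $T$ the definition is the same, with $n\mapsto L(T^n(x))$, $n\in\mathbb N$, in place of $t\mapsto L(\phi^t(x))$ and with the chain recurrent set and components of $T$. **Theorem.** Let $\phi^t$ be a semiflow on a metric space $X$, let $\ell:X\to[0,1]$ be a complete Lyapunov function for its time-one map $\phi^1$, and put $$L(x)=\int_0^1\ell(\phi^t(x))\,dt .$$ Then $L$ is a complete Lyapunov function for the semiflow. Moreover: - if for every $c\in\ell(\mathcal R_C(\phi^1))$ the whole level set $\ell^{-1}(c)$ is a chain transitive component for $\phi^1$, then for every $c\in L(\mathcal R_C(\phi^t))$ the whole level set $L^{-1}(c)$ is a chain transitive component for the semiflow; - if $n\mapsto\ell(\phi^n(x))$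 is strictly decreasing on all of $\mathbb N$ for every $x\notin\mathcal R_C(\phi^1)$, then $t\mapsto L(\phi^t(x))$ is strictly decreasing on all of $[0,\infty)$ for every $x\notin\mathcal R_C(\phi^t)$. Finally, if $X$ is separable, then every semiflow on $X$ has a complete Lyapunov function. -/

import Mathlib

open Set
open scoped NNReal

/-- `x` is joined to `y` by `ε`-chains of the map `T`, for every continuous positive function `ε`:
there are `n ≥ 1` and `x = x₀, x₁, …, xₙ = y` with `d(T xᵢ, xᵢ₊₁) < ε (T xᵢ)`. -/
def MapChains {X : Type*} [MetricSpace X] (T : X → X) (x y : X) : Prop :=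
  ∀ ε : X → ℝ, Continuous ε → (∀ z, 0 < ε z) →
    Relation.TransGen (fun u v => dist (T u) v < ε (T u)) x y

/-- `x` is joined to `y` by `(ε, T)`-chains of the semiflow `φ`, for every continuous positive
function `ε` and every time `T`: there are `n ≥ 1`, points `x = x₀, x₁, …, xₙ = y` and times
`tᵢ ≥ T` with `d(φ^{tᵢ} xᵢ, xᵢ₊₁) < ε (φ^{tᵢ} xᵢ)`. A semiflow is a jointly continuous action of
the additive monoid `[0, ∞)`, that is, a term of `Flow ℝ≥0 X`. -/
def SemiflowChains {X : Type*} [MetricSpace X] (φ : Flow ℝ≥0 X) (x y : X) : Prop :=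
  ∀ ε : X → ℝ, Continuous ε → (∀ z, 0 < ε z) → ∀ T : ℝ≥0, 0 < T →
    Relation.TransGen (fun u v => ∃ t : ℝ≥0, T ≤ t ∧ dist (φ t u) v < ε (φ t u)) x y

/-- The chain recurrent set attached to a relation "joined by arbitrarily fine chains". -/
def chainRecurrentSet {X : Type*} (chains : X → X → Prop) : Set X :=
  {x | chains x x}

/-- `C` is a chain transitive component of the chain recurrent set: a class of the equivalence
relation "joined by arbitrarily fine chains in both directions" on that set. -/
def IsChainComponent {X : Type*} (chains : X → X → Prop) (C : Set X) : Prop :=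
  ∃ x ∈ chainRecurrentSet chains,
    C = {y | y ∈ chainRecurrentSet chains ∧ chains x y ∧ chains y x}

/-- The requirements on a complete Lyapunov function, for a system `Φ : τ → X → X` with time set
`τ` (`ℕ` for the iterates of a map, `[0, ∞)` for a semiflow) and its chain relation `chains`. -/
structure IsCompleteLyapunovFor {τ X : Type*} [Preorder τ] [MetricSpace X] (Φ : τ → X → X)
    (chains : X → X → Prop) (L : X → ℝ) : Prop where
  continuous : Continuous L
  mem_Icc : ∀ x, L x ∈ Icc (0 : ℝ) 1
  /-- `L` is constant along the orbits of chain recurrent points. -/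
  const : ∀ x ∈ chainRecurrentSet chains, ∀ s t : τ, L (Φ s x) = L (Φ t x)
  /-- `L` never increases along the orbits of the other points ... -/
  antitone : ∀ x ∉ chainRecurrentSet chains, Antitone fun t : τ => L (Φ t x)
  /-- ... and it decreases strictly as long as such an orbit is off the chain recurrent set. -/
  strict : ∀ x ∉ chainRecurrentSet chains, ∀ s t : τ, s < t →
    Φ s x ∉ chainRecurrentSet chains → L (Φ t x) < L (Φ s x)
  /-- The values on the chain recurrent set are nowhere dense in `[0, 1]`. -/
  nowhereDense : IsNowhereDense {c : Icc (0 : ℝ) 1 | (c : ℝ) ∈ L '' chainRecurrentSet chains}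
  /-- The level sets of `L` on the chain recurrent set are the chain transitive components. -/
  level : ∀ c ∈ L '' chainRecurrentSet chains,
    IsChainComponent chains (L ⁻¹' {c} ∩ chainRecurrentSet chains)

/-- Complete Lyapunov functions of a map. -/
def IsCompleteLyapunovMap {X : Type*} [MetricSpace X] (T : X → X) (L : X → ℝ) : Prop :=
  IsCompleteLyapunovFor (fun n : ℕ => T^[n]) (MapChains T) L

/-- Complete Lyapunov functions of a semiflow. -/
def IsCompleteLyapunovSemiflow {X : Type*} [MetricSpace X] (φ : Flow ℝ≥0 X) (L : X → ℝ) : Prop :=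
  IsCompleteLyapunovFor (fun (t : ℝ≥0) x => φ t x) (SemiflowChains φ) L

/-- The average `L(x) = ∫₀¹ ℓ(φ^t(x)) dt` of a function over orbit segments of length one. -/
noncomputable def orbitAverage {X : Type*} [MetricSpace X] (φ : Flow ℝ≥0 X) (l : X → ℝ) (x : X) :
    ℝ :=
  ∫ t in (0 : ℝ)..1, l (φ t.toNNReal x)

open Relation Topology

/-! ### Chains measured by open neighbourhoods of the diagonal -/

section Diagonal

variable {X : Type*} [MetricSpace X]

/-! The semiflow and its time-one map have the same chain recurrent set and components
(`chainRecurrentSet_semiflow_eq`, `isChainComponent_semiflow_iff`). Without compactness, errors are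
controlled by open neighbourhoods of the diagonal, which pull back under continuous maps. A long
chain of the map is cut into blocks that follow true orbits, giving long flow times. Conversely, a
chain of the flow has non-integer times: points are moved along their orbits to make these integral,
and the leftover phase is absorbed by many turns around a loop at the recurrent end point, with a
small drift per turn.

The function `l` is constant on components, hence along recurrent orbits, so `L = l` on the
recurrent set. Along any orbit the decrease of `L` from time `s` to time `t` is the integral over
`[s, t]` of the decrease of `l` under `φ 1` (`orbitAverage_flow_sub`), which gives monotonicity and
strictness.

Existence is Conley's construction for `φ 1`: points reached by `ε`-chains form an attracting set,
which yields a Lyapunov function with values 0 and 1 on the recurrent set. Countably many suffice by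
the Lindelöf property, and summing them with weights `3⁻ⁿ` sends the recurrent set into a Cantor
set. -/

theorem exists_continuous_forall_dist_lt_mem {W : Set (X × X)} (hW : IsOpen W)
    (hd : ∀ z, (z, z) ∈ W) :
    ∃ ε : X → ℝ, Continuous ε ∧ (∀ z, 0 < ε z) ∧ (∀ z w, ε z ≤ ε w + dist z w) ∧
      ∀ z w, dist z w < ε z → (z, w) ∈ W := by
  rcases (Wᶜ).eq_empty_or_nonempty with h | h
  · refine ⟨fun _ => 1, continuous_const, fun _ => one_pos, fun z w => by simp, fun z w _ => ?_⟩
    have : W = univ := compl_empty_iff.mp h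
    simp [this]
  · refine ⟨fun z => Metric.infDist (z, z) Wᶜ,
      (Metric.continuous_infDist_pt _).comp (continuous_id.prodMk continuous_id),
      fun z => (hW.isClosed_compl.notMem_iff_infDist_pos h).1 (not_not.2 (hd z)), fun z w => ?_,
      fun z w hzw => ?_⟩
    · simpa [Prod.dist_eq] using Metric.infDist_le_infDist_add_dist (x := (z, z)) (y := (w, w))
        (s := Wᶜ)
    · by_contra hmem
      have := Metric.infDist_le_dist_of_mem (x := (z, z)) (show (z, w) ∈ Wᶜ from hmem)
      simp only [Prod.dist_eq, dist_self] at this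
      rw [max_eq_right dist_nonneg] at this
      exact absurd hzw this.not_gt

theorem isOpen_setOf_dist_lt {ε : X → ℝ} (hε : Continuous ε) :
    IsOpen {p : X × X | dist p.1 p.2 < ε p.1} :=
  isOpen_lt continuous_dist (hε.comp continuous_fst)

/-- Open neighbourhoods of the diagonal of a metric space can be halved. -/
theorem exists_isOpen_diagonal_comp_subset {W : Set (X × X)} (hW : IsOpen W)
    (hd : ∀ z, (z, z) ∈ W) :
    ∃ V : Set (X × X), IsOpen V ∧ (∀ z, (z, z) ∈ V) ∧
      ∀ x y z, (x, y) ∈ V → (y, z) ∈ V → (x, z) ∈ W := by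
  obtain ⟨ε, hε, hpos, hlip, hmem⟩ := exists_continuous_forall_dist_lt_mem hW hd
  -- As `ε` is 1-Lipschitz, `ε y < (5/4) ε x`, so the two steps total less than `(1/4 + 5/16) ε x`.
  refine ⟨_, isOpen_setOf_dist_lt (hε.div_const 4), fun z => by simpa using hpos z,
    fun x y z hxy hyz => hmem _ _ ?_⟩
  simp only [mem_ofPred_eq] at hxy hyz
  have h1 := hlip y x
  rw [dist_comm] at h1
  linarith [dist_triangle x y z, hpos x]

theorem mapChains_iff {T : X → X} {x y : X} :
    MapChains T x y ↔ ∀ W : Set (X × X), IsOpen W → (∀ z, (z, z) ∈ W) →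
      TransGen (fun u v => (T u, v) ∈ W) x y := by
  refine ⟨fun h W hW hd => ?_, fun h ε hε hpos => ?_⟩
  · obtain ⟨ε, hε, hpos, -, hmem⟩ := exists_continuous_forall_dist_lt_mem hW hd
    exact TransGen.mono (fun u v => hmem (T u) v) x y (h ε hε hpos)
  · exact h _ (isOpen_setOf_dist_lt hε) fun z => by simpa using hpos z

theorem semiflowChains_iff {φ : Flow ℝ≥0 X} {x y : X} :
    SemiflowChains φ x y ↔ ∀ W : Set (X × X), IsOpen W → (∀ z, (z, z) ∈ W) → ∀ T : ℝ≥0, 0 < T →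
      TransGen (fun u v => ∃ t, T ≤ t ∧ (φ t u, v) ∈ W) x y := by
  refine ⟨fun h W hW hd T hT => ?_, fun h ε hε hpos => ?_⟩
  · obtain ⟨ε, hε, hpos, -, hmem⟩ := exists_continuous_forall_dist_lt_mem hW hd
    refine TransGen.mono ?_ x y (h ε hε hpos T hT)
    rintro u v ⟨t, ht, h⟩
    exact ⟨t, ht, hmem _ _ h⟩
  · exact h _ (isOpen_setOf_dist_lt hε) fun z => by simpa using hpos z

theorem MapChains.trans {T : X → X} {x y z : X} (h : MapChains T x y) (h' : MapChains T y z) :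
    MapChains T x z :=
  fun ε hε hpos => (h ε hε hpos).trans (h' ε hε hpos)

theorem SemiflowChains.trans {φ : Flow ℝ≥0 X} {x y z : X} (h : SemiflowChains φ x y)
    (h' : SemiflowChains φ y z) : SemiflowChains φ x z :=
  fun ε hε hpos T hT => (h ε hε hpos T hT).trans (h' ε hε hpos T hT)

/-- The pairs that stay `W`-close for all times in a compact set form an open set. -/
theorem isOpen_setOf_forall_flow_mem (φ : Flow ℝ≥0 X) {W : Set (X × X)} (hW : IsOpen W)
    {K : Set ℝ≥0} (hK : IsCompact K) :
    IsOpen {p : X × X | ∀ s ∈ K, (φ s p.1, φ s p.2) ∈ W} := by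
  refine isOpen_iff_mem_nhds.2 fun p hp => ?_
  refine hK.eventually_forall_of_forall_eventually fun s hs => ?_
  have hc : Continuous fun q : (X × X) × ℝ≥0 => (φ q.2 q.1.1, φ q.2 q.1.2) := by fun_prop
  exact hc.continuousAt.eventually (hW.mem_nhds (hp s hs))

end Diagonal

/-! ### From chains of the time-one map to chains of the semiflow -/

section Iterates

variable {X : Type*} [MetricSpace X]

/-- `relPow r n x y`: `x` is joined to `y` by exactly `n` steps of the relation `r`. -/
def relPow {α : Type*} (r : α → α → Prop) : ℕ → α → α → Prop
  | 0, x, y => x = y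
  | n + 1, x, y => ∃ z, relPow r n x z ∧ r z y

theorem relPow_add {α : Type*} {r : α → α → Prop} {m n : ℕ} {x z : α} :
    relPow r (m + n) x z ↔ ∃ y, relPow r m x y ∧ relPow r n y z := by
  induction n generalizing z with
  | zero => simp [relPow]
  | succ n ih =>
    constructor
    · rintro ⟨a, h, h3⟩
      obtain ⟨b, h1, h2⟩ := ih.1 h
      exact ⟨b, h1, a, h2, h3⟩
    · rintro ⟨b, h1, a, h2, h3⟩
      exact ⟨a, ih.2 ⟨b, h1, h2⟩, h3⟩

theorem exists_relPow_of_transGen {α : Type*} {r : α → α → Prop} {x y : α} (h : TransGen r x y) :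
    ∃ n, relPow r (n + 1) x y := by
  induction h with
  | single h => exact ⟨0, x, rfl, h⟩
  | tail _ h ih =>
    obtain ⟨n, hn⟩ := ih
    exact ⟨n + 1, _, hn, h⟩

theorem transGen_of_relPow {α : Type*} {r : α → α → Prop} {n : ℕ} {x y : α}
    (h : relPow r (n + 1) x y) : TransGen r x y := by
  induction n generalizing y with
  | zero =>
    obtain ⟨z, rfl, hz⟩ := h
    exact .single hz
  | succ n ih =>
    obtain ⟨z, h, hz⟩ := h
    exact (ih h).tail hz

theorem relPow_mul_self {α : Type*} {r : α → α → Prop} {n : ℕ} {x : α} (h : relPow r n x x)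
    (k : ℕ) : relPow r (n * k) x x := by
  induction k with
  | zero => rfl
  | succ k ih => exact relPow_add.2 ⟨x, ih, h⟩

/-- A chain of at least `N` steps splits into blocks of between `N` and `2 * N` steps. -/
theorem transGen_blocks_of_relPow {α : Type*} {r : α → α → Prop} {N : ℕ} (hN : 0 < N) (k : ℕ)
    {x y : α} (h : relPow r (N + k) x y) :
    TransGen (fun u v => ∃ m, N ≤ m ∧ m ≤ 2 * N ∧ relPow r m u v) x y := by
  induction k using Nat.strong_induction_on generalizing x with
  | _ k ih =>
    rcases lt_or_ge k N with hk | hk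
    · exact .single ⟨N + k, by omega, by omega, h⟩
    · obtain ⟨z, h1, h2⟩ := relPow_add.1 h
      refine TransGen.head ⟨N, le_rfl, by omega, h1⟩ (ih (k - N) (by omega) ?_)
      rwa [Nat.add_sub_cancel' hk]

/-- Fine pseudo-orbits of bounded length follow true orbits. -/
theorem exists_isOpen_relPow_iterate_mem {T : X → X} (hT : Continuous T) (N : ℕ)
    {W : Set (X × X)} (hW : IsOpen W) (hd : ∀ z, (z, z) ∈ W) :
    ∃ V : Set (X × X), IsOpen V ∧ (∀ z, (z, z) ∈ V) ∧
      ∀ m ≤ N, ∀ x y, relPow (fun u v => (T u, v) ∈ V) m x y → (T^[m] x, y) ∈ W := by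
  induction N generalizing W with
  | zero =>
    refine ⟨univ, isOpen_univ, fun _ => mem_univ _, fun m hm x y h => ?_⟩
    obtain rfl : m = 0 := by omega
    obtain rfl : x = y := h
    exact hd x
  | succ N ih =>
    obtain ⟨V₁, hV₁, hd₁, hcomp⟩ := exists_isOpen_diagonal_comp_subset hW hd
    -- Pulling `V₁` back under `T` keeps the accumulated error in `V₁` after one more application of
    -- `T`; the last jump adds a second `V₁`.
    obtain ⟨V, hV, hdV, h⟩ := ih (W := {p | (T p.1, T p.2) ∈ V₁})
      (hV₁.preimage (by fun_prop)) fun z => hd₁ _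
    refine ⟨V ∩ V₁, hV.inter hV₁, fun z => ⟨hdV z, hd₁ z⟩, fun m hm x y hxy => ?_⟩
    have mono : ∀ n x y, relPow (fun u v => (T u, v) ∈ V ∩ V₁) n x y →
        relPow (fun u v => (T u, v) ∈ V) n x y := by
      intro n
      induction n with
      | zero => exact fun x y h => h
      | succ n ih => exact fun x y ⟨z, h, h'⟩ => ⟨z, ih _ _ h, h'.1⟩
    cases m with
    | zero =>
      obtain rfl : x = y := hxy
      exact hd x
    | succ m =>
      obtain ⟨z, hxz, hzy⟩ := hxy
      rw [Function.iterate_succ_apply']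
      exact hcomp _ _ _ (h m (by omega) x z (mono _ _ _ hxz)) hzy.2

theorem MapChains.apply_right {T : X → X} (x : X) : MapChains T x (T x) :=
  fun ε _ hpos => .single (by simpa using hpos (T x))

/-- A chain recurrent point is reached by chains from its image. -/
theorem MapChains.apply_left {T : X → X} (hT : Continuous T) {x : X} (h : MapChains T x x) :
    MapChains T (T x) x := by
  rw [mapChains_iff] at h ⊢
  intro W hW hd
  obtain ⟨V, hV, hdV, hVW⟩ := exists_isOpen_relPow_iterate_mem hT 2 hW hd
  obtain ⟨n, hn⟩ := exists_relPow_of_transGen (h (V ∩ W) (hV.inter hW) fun z => ⟨hdV z, hd z⟩)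
  -- Going round twice guarantees two steps `x → y → z`; these are replaced by the single jump from
  -- `T x` to `z`, since `T (T x)` is `W`-close to `z`.
  have hn2 := relPow_mul_self hn 2
  rw [show (n + 1) * 2 = 2 + 2 * n by ring] at hn2
  obtain ⟨z, ⟨y, ⟨_, rfl, hxy⟩, hyz⟩, hzx⟩ := relPow_add.1 hn2
  have hz : TransGen (fun u v => (T u, v) ∈ W) (T x) z :=
    .single (hVW 2 le_rfl x z ⟨y, ⟨x, rfl, hxy.1⟩, hyz.1⟩)
  cases n with
  | zero =>
    obtain rfl : z = x := hzx
    exact hz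
  | succ n =>
    rw [show 2 * (n + 1) = (2 * n + 1) + 1 by ring] at hzx
    refine hz.trans (TransGen.mono ?_ _ _ (transGen_of_relPow hzx))
    exact fun u v h => h.2

theorem flow_one_iterate (φ : Flow ℝ≥0 X) (n : ℕ) (x : X) :
    (fun x => φ 1 x)^[n] x = φ n x := by
  induction n with
  | zero => simp
  | succ n ih => rw [Function.iterate_succ_apply', ih, ← φ.map_add, Nat.cast_succ, add_comm]

/-- Chains of the time-one map that end in a chain recurrent point give chains of the semiflow. -/
theorem MapChains.semiflowChains {φ : Flow ℝ≥0 X} {x y : X} (h : MapChains (fun x => φ 1 x) x y)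
    (hy : MapChains (fun x => φ 1 x) y y) : SemiflowChains φ x y := by
  rw [mapChains_iff] at h hy
  rw [semiflowChains_iff]
  intro W hW hd T hT
  obtain ⟨N, hN⟩ := exists_nat_ge T
  have hN0 : 0 < N := by exact_mod_cast hT.trans_le hN
  obtain ⟨V, hV, hdV, hVW⟩ :=
    exists_isOpen_relPow_iterate_mem (φ.continuous_toFun 1) (2 * N) hW hd
  obtain ⟨m, hm⟩ := exists_relPow_of_transGen (h V hV hdV)
  obtain ⟨n, hn⟩ := exists_relPow_of_transGen (hy V hV hdV)
  -- Appending `N` loops at `y` makes the chain long enough to be cut into blocks.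
  have hlong := relPow_add.2 ⟨y, hm, relPow_mul_self hn N⟩
  rw [show m + 1 + (n + 1) * N = N + (m + 1 + n * N) by ring] at hlong
  refine TransGen.mono ?_ _ _ (transGen_blocks_of_relPow hN0 _ hlong)
  rintro u v ⟨k, hk, hk', huv⟩
  refine ⟨k, hN.trans (by exact_mod_cast hk), ?_⟩
  rw [← flow_one_iterate]
  exact hVW k hk' u v huv

end Iterates

/-! ### From chains of the semiflow to chains of the time-one map -/

section FlowToMap

variable {X : Type*} [MetricSpace X]

/-- Only the last jump changes: its time grows by `s`, and its error is controlled by also requiring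
it to lie in the preimage of `W` under `φ s`. -/
theorem SemiflowChains.flow_right {φ : Flow ℝ≥0 X} {x y : X} (h : SemiflowChains φ x y)
    (s : ℝ≥0) : SemiflowChains φ x (φ s y) := by
  rw [semiflowChains_iff] at h ⊢
  intro W hW hd T hT
  have hc : Continuous fun p : X × X => (φ s p.1, φ s p.2) := by fun_prop
  obtain ⟨z, hxz, t, ht, hzy⟩ := TransGen.tail'_iff.1 <|
    h (W ∩ (fun p : X × X => (φ s p.1, φ s p.2)) ⁻¹' W) (hW.inter (hW.preimage hc))
      (fun z => ⟨hd z, hd _⟩) T hT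
  refine TransGen.tail' (ReflTransGen.mono ?_ _ _ hxz) ⟨s + t, ht.trans le_add_self, ?_⟩
  · rintro u v ⟨t, ht, huv⟩
    exact ⟨t, ht, huv.1⟩
  · rw [φ.map_add]
    exact hzy.2

/-- Chains with times at least `T + s` can spare `s` from their first time. -/
theorem SemiflowChains.flow_left {φ : Flow ℝ≥0 X} {x y : X} (h : SemiflowChains φ x y)
    (s : ℝ≥0) : SemiflowChains φ (φ s x) y := by
  rw [semiflowChains_iff] at h ⊢
  intro W hW hd T hT
  obtain ⟨z, ⟨t, ht, hxz⟩, hzy⟩ := TransGen.head'_iff.1 <|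
    h W hW hd (T + s) (hT.trans_le le_self_add)
  refine TransGen.head' ⟨t - s, le_tsub_of_add_le_right ht, ?_⟩ (ReflTransGen.mono ?_ _ _ hzy)
  · rwa [← φ.map_add, tsub_add_cancel_of_le (le_add_self.trans ht)]
  · rintro u v ⟨t, ht, huv⟩
    exact ⟨t, le_self_add.trans ht, huv⟩

/-- All steps but the last follow the true orbit exactly. -/
theorem transGen_of_flow_natCast_mem {φ : Flow ℝ≥0 X} {V : Set (X × X)} (hd : ∀ z, (z, z) ∈ V)
    (n : ℕ) {z w : X} (h : (φ (n + 1) z, w) ∈ V) :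
    TransGen (fun u v => (φ 1 u, v) ∈ V) z w := by
  induction n generalizing z with
  | zero => exact .single (by simpa using h)
  | succ n ih =>
    refine TransGen.head (b := φ 1 z) (hd _) (ih ?_)
    rw [← φ.map_add]
    exact_mod_cast h

theorem exists_mem_Icc_zero_one_add_int (c : ℝ) : ∃ b : ℝ≥0, b ≤ 1 ∧ ∃ k : ℤ, (b : ℝ) + c = k := by
  refine ⟨⟨Int.fract (-c), Int.fract_nonneg _⟩, ?_, -⌊-c⌋, ?_⟩
  · exact_mod_cast (Int.fract_lt_one (-c)).le
  · have := Int.floor_add_fract (-c)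
    push_cast
    change Int.fract (-c) + c = _
    linarith

/-- A chain of the semiflow gives chains of the time-one map between points of the orbits of the
end points, at phases whose difference modulo one is dictated by the duration `τ` of the chain. -/
theorem exists_forall_transGen_of_phase {φ : Flow ℝ≥0 X} {V W U : Set (X × X)}
    (hdV : ∀ z, (z, z) ∈ V) (hdW : ∀ z, (z, z) ∈ W)
    (hVW : ∀ x y z, (x, y) ∈ V → (y, z) ∈ V → (x, z) ∈ W)
    (hU : ∀ z w, (z, w) ∈ U → ∀ s ≤ 1, (φ s z, φ s w) ∈ V) {x y : X}
    (h : TransGen (fun u v => ∃ t, (3 : ℝ≥0) ≤ t ∧ (φ t u, v) ∈ U) x y) :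
    ∃ τ : ℝ, ∀ a b : ℝ≥0, a ≤ 2 → b ≤ 1 → (∃ k : ℤ, (b : ℝ) - a + τ = k) →
      ∀ w, (φ b y, w) ∈ V → TransGen (fun u v => (φ 1 u, v) ∈ W) (φ a x) w := by
  have step : ∀ u v, (∃ t, (3 : ℝ≥0) ≤ t ∧ (φ t u, v) ∈ U) →
      ∃ τ : ℝ, ∀ a b : ℝ≥0, a ≤ 2 → b ≤ 1 → (∃ k : ℤ, (b : ℝ) - a + τ = k) →
      ∀ w, (φ b v, w) ∈ V → TransGen (fun u v => (φ 1 u, v) ∈ W) (φ a u) w := by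
    rintro u v ⟨t, ht, huv⟩
    refine ⟨t, fun a b ha hb ⟨k, hk⟩ w hw => ?_⟩
    have ha' : (a : ℝ) ≤ 2 := by exact_mod_cast ha
    have ht' : (3 : ℝ) ≤ t := by exact_mod_cast ht
    -- Times at least 3 and starting phases at most 2 leave room for at least one unit step. Phases
    -- exceed 1 only through the drift added later.
    have hk1 : 1 ≤ k := by
      have : (1 : ℝ) ≤ k := by linarith [b.2]
      exact_mod_cast this
    obtain ⟨n, rfl⟩ : ∃ n : ℕ, k = n + 1 := ⟨(k - 1).toNat, by omega⟩
    have hn : (n + 1 : ℝ≥0) + a = b + t := by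
      apply NNReal.eq
      push_cast at hk ⊢
      linarith
    refine transGen_of_flow_natCast_mem hdW n ?_
    rw [← φ.map_add, hn, φ.map_add]
    exact hVW _ _ _ (hU _ _ huv b hb) hw
  induction h with
  | single h => exact step _ _ h
  | tail _ h ih =>
    obtain ⟨τ, hτ⟩ := ih
    obtain ⟨σ, hσ⟩ := step _ _ h
    refine ⟨τ + σ, fun a c ha hc ⟨k, hk⟩ w hw => ?_⟩
    -- The intermediate phase `b` makes the first part last an integer time; the second part then
    -- starts at `b` with no error.
    obtain ⟨b, hb, m, hm⟩ := exists_mem_Icc_zero_one_add_int (τ - a)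
    refine (hτ a b ha hb ⟨m, by rw [← hm]; ring⟩ _ (hdV _)).trans
      (hσ b c (hb.trans one_le_two) hc ⟨k - m, ?_⟩ w hw)
    push_cast
    rw [← hk, ← hm]
    ring

/-- Compactness of the phase interval makes the admissible drift uniform in the phase. -/
theorem exists_pos_forall_flow_add_mem (φ : Flow ℝ≥0 X) {V : Set (X × X)} (hV : IsOpen V)
    (hd : ∀ z, (z, z) ∈ V) (y : X) :
    ∃ δ : ℝ, 0 < δ ∧ ∀ η : ℝ≥0, η < δ → ∀ b ≤ 1, (φ b y, φ (b + η) y) ∈ V := by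
  have hev : ∀ᶠ η in 𝓝 (0 : ℝ≥0), ∀ b ∈ Icc (0 : ℝ≥0) 1, (φ b y, φ (b + η) y) ∈ V := by
    refine isCompact_Icc.eventually_forall_of_forall_eventually fun b _ => ?_
    have hc : Continuous fun q : ℝ≥0 × ℝ≥0 => (φ q.2 y, φ (q.2 + q.1) y) := by fun_prop
    exact hc.continuousAt.eventually (hV.mem_nhds (by simpa using hd _))
  obtain ⟨δ, hδ, h⟩ := Metric.eventually_nhds_iff.1 hev
  refine ⟨δ, hδ, fun η hη b hb => h ?_ b ⟨zero_le, hb⟩⟩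
  simpa [NNReal.dist_eq] using hη

/-- Chains of the semiflow that end in a chain recurrent point give chains of the time-one map.
Turning around a loop at the end point many times, with a small drift along its orbit each time,
makes up for the fractional part of the duration of the chain. -/
theorem SemiflowChains.mapChains {φ : Flow ℝ≥0 X} {x y : X} (h : SemiflowChains φ x y)
    (hy : SemiflowChains φ y y) : MapChains (fun x => φ 1 x) x y := by
  rw [semiflowChains_iff] at h hy
  rw [mapChains_iff]
  intro W hW hd
  obtain ⟨V, hV, hdV, hVW⟩ := exists_isOpen_diagonal_comp_subset hW hd
  have hUo := isOpen_setOf_forall_flow_mem φ hV (isCompact_Icc (a := (0 : ℝ≥0)) (b := 1))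
  set U := {p : X × X | ∀ s ∈ Icc (0 : ℝ≥0) 1, (φ s p.1, φ s p.2) ∈ V}
  have hU : ∀ z w, (z, w) ∈ U → ∀ s ≤ 1, (φ s z, φ s w) ∈ V :=
    fun z w hzw s hs => hzw s ⟨zero_le, hs⟩
  have hdU : ∀ z, (z, z) ∈ U := fun z s _ => hdV _
  obtain ⟨σ, hσ⟩ := exists_forall_transGen_of_phase hdV hd hVW hU (h U hUo hdU 3 three_pos)
  obtain ⟨τ, hτ⟩ := exists_forall_transGen_of_phase hdV hd hVW hU (hy U hUo hdU 3 three_pos)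
  obtain ⟨δ, hδ, hdrift⟩ := exists_pos_forall_flow_add_mem φ hV hdV y
  obtain ⟨a, ha, m, hm⟩ := exists_mem_Icc_zero_one_add_int σ
  have h1 := hσ 0 a zero_le ha ⟨m, by simpa using hm⟩ _ (hdV _)
  rw [φ.map_zero_apply] at h1
  refine h1.trans ?_
  obtain ⟨N, hN⟩ := exists_nat_gt (max 1 (1 / δ))
  have hN1 : (1 : ℝ) < N := (le_max_left _ _).trans_lt hN
  have hNδ : 1 / (N : ℝ) < δ :=
    (one_div_lt hδ (by linarith)).1 ((le_max_right _ _).trans_lt hN)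
  -- `c` is the total drift needed to return to phase 0 after `N + 1` turns; it is split into `N`
  -- drifts `η = c / N < δ`, one between consecutive turns.
  obtain ⟨c, hc, p, hp⟩ := exists_mem_Icc_zero_one_add_int (a - (N + 1) * τ)
  obtain ⟨η, hη⟩ : ∃ η : ℝ≥0, (η : ℝ) = c / N := ⟨c / N, by simp⟩
  have hc' : (c : ℝ) ≤ 1 := by exact_mod_cast hc
  have hηN : (η : ℝ) ≤ 1 / N := by
    rw [hη]
    gcongr
  have hη1 : η ≤ 1 := by
    have : (η : ℝ) ≤ 1 := hηN.trans ((div_le_one (by linarith)).2 hN1.le)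
    exact_mod_cast this
  -- After `j + 1` turns only `j` drifts have been made: the error allowed at the end of the last
  -- turn stays free for `w`.
  have key : ∀ j : ℕ, ∀ b : ℝ≥0, b ≤ 1 → (∃ k : ℤ, (b : ℝ) - a + (j + 1) * τ - j * η = k) →
      ∀ w, (φ b y, w) ∈ V → TransGen (fun u v => (φ 1 u, v) ∈ W) (φ a y) w := by
    intro j
    induction j with
    | zero =>
      rintro b hb ⟨k, hk⟩ w hw
      exact hτ a b (ha.trans one_le_two) hb ⟨k, by rw [← hk]; simp⟩ w hw
    | succ j ih =>
      rintro b hb ⟨k, hk⟩ w hw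
      obtain ⟨b', hb', q, hq⟩ := exists_mem_Icc_zero_one_add_int (-a + (j + 1) * τ - j * η)
      refine (ih b' hb' ⟨q, by rw [← hq]; ring⟩ (φ (b' + η) y)
        (hdrift η (hηN.trans_lt hNδ) b' hb')).trans
        (hτ (b' + η) b ?_ hb ⟨k - q, ?_⟩ w hw)
      · calc b' + η ≤ 1 + 1 := add_le_add hb' hη1
          _ = 2 := one_add_one_eq_two
      · push_cast at hk ⊢
        rw [← hk, ← hq]
        ring
  refine key N 0 zero_le ⟨-p, ?_⟩ y (by simpa using hdV y)
  have hNη : (N : ℝ) * η = c := by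
    rw [hη]
    field_simp
  push_cast
  rw [hNη, ← hp]
  ring

theorem semiflowChains_self_iff {φ : Flow ℝ≥0 X} {x : X} :
    SemiflowChains φ x x ↔ MapChains (fun x => φ 1 x) x x :=
  ⟨fun h => h.mapChains h, fun h => h.semiflowChains h⟩

/-- A semiflow and its time-one map have the same chain recurrent set. -/
theorem chainRecurrentSet_semiflow_eq (φ : Flow ℝ≥0 X) :
    chainRecurrentSet (SemiflowChains φ) = chainRecurrentSet (MapChains fun x => φ 1 x) :=
  Set.ext fun _ => semiflowChains_self_iff

/-- A semiflow and its time-one map have the same chain transitive components. -/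
theorem isChainComponent_semiflow_iff {φ : Flow ℝ≥0 X} {C : Set X} :
    IsChainComponent (SemiflowChains φ) C ↔ IsChainComponent (MapChains fun x => φ 1 x) C := by
  have key : ∀ x y, SemiflowChains φ y y →
      (SemiflowChains φ x y ↔ MapChains (fun x => φ 1 x) x y) := fun x y hy =>
    ⟨fun h => h.mapChains hy, fun h => h.semiflowChains (semiflowChains_self_iff.1 hy)⟩
  have hset : ∀ x ∈ chainRecurrentSet (SemiflowChains φ),
      {y | y ∈ chainRecurrentSet (SemiflowChains φ) ∧ SemiflowChains φ x y ∧
        SemiflowChains φ y x} =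
      {y | y ∈ chainRecurrentSet (MapChains fun x => φ 1 x) ∧ MapChains (fun x => φ 1 x) x y ∧
        MapChains (fun x => φ 1 x) y x} := by
    intro x hx
    ext y
    rw [← chainRecurrentSet_semiflow_eq]
    refine and_congr_right fun hy => ?_
    rw [key x y hy, key y x hx]
  unfold IsChainComponent
  rw [← chainRecurrentSet_semiflow_eq] at hset ⊢
  refine exists_congr fun x => and_congr_right fun hx => ?_
  rw [hset x hx]

end FlowToMap

/-! ### Averaging along orbits -/

section OrbitAverage

variable {X : Type*} [MetricSpace X]

namespace IsCompleteLyapunovMap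

variable {T : X → X} {l : X → ℝ}

theorem apply_le (hl : IsCompleteLyapunovMap T l) (x : X) : l (T x) ≤ l x := by
  by_cases hx : x ∈ chainRecurrentSet (MapChains T)
  · exact (hl.const x hx 1 0).le
  · exact hl.antitone x hx zero_le_one

theorem apply_lt (hl : IsCompleteLyapunovMap T l) {x : X}
    (hx : x ∉ chainRecurrentSet (MapChains T)) : l (T x) < l x :=
  hl.strict x hx 0 1 one_pos hx

theorem eq_of_chains (hl : IsCompleteLyapunovMap T l) {x y : X} (hxy : MapChains T x y)
    (hyx : MapChains T y x) : l y = l x := by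
  have hx : x ∈ chainRecurrentSet (MapChains T) := hxy.trans hyx
  obtain ⟨z, -, hz⟩ := hl.level (l x) ⟨x, hx, rfl⟩
  have hxm : x ∈ l ⁻¹' {l x} ∩ chainRecurrentSet (MapChains T) := ⟨rfl, hx⟩
  rw [hz] at hxm
  have hym : y ∈ l ⁻¹' {l x} ∩ chainRecurrentSet (MapChains T) := by
    rw [hz]
    exact ⟨hyx.trans hxy, hxm.2.1.trans hxy, hyx.trans hxm.2.2⟩
  exact hym.1

end IsCompleteLyapunovMap

theorem flow_mem_chainRecurrentSet {φ : Flow ℝ≥0 X} {x : X}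
    (hx : x ∈ chainRecurrentSet (SemiflowChains φ)) (t : ℝ≥0) :
    φ t x ∈ chainRecurrentSet (SemiflowChains φ) :=
  SemiflowChains.flow_right (SemiflowChains.flow_left hx t) t

theorem continuous_comp_flow_toNNReal (φ : Flow ℝ≥0 X) {l : X → ℝ} (hl : Continuous l) (x : X) :
    Continuous fun u : ℝ => l (φ u.toNNReal x) :=
  hl.comp (φ.continuous continuous_real_toNNReal continuous_const)

theorem continuous_orbitAverage (φ : Flow ℝ≥0 X) {l : X → ℝ} (hl : Continuous l) :
    Continuous (orbitAverage φ l) := by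
  refine intervalIntegral.continuous_parametric_intervalIntegral_of_continuous'
    (μ := MeasureTheory.volume) (f := fun x (t : ℝ) => l (φ t.toNNReal x)) ?_ 0 1
  exact hl.comp (φ.continuous (continuous_real_toNNReal.comp continuous_snd) continuous_fst)

theorem orbitAverage_mem_Icc (φ : Flow ℝ≥0 X) {l : X → ℝ} (hl : Continuous l)
    (h01 : ∀ x, l x ∈ Icc (0 : ℝ) 1) (x : X) : orbitAverage φ l x ∈ Icc (0 : ℝ) 1 := by
  refine ⟨intervalIntegral.integral_nonneg zero_le_one fun t _ => (h01 _).1, ?_⟩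
  have := intervalIntegral.integral_mono_on (zero_le_one (α := ℝ))
    ((continuous_comp_flow_toNNReal φ hl x).intervalIntegrable (μ := MeasureTheory.volume) 0 1)
    (intervalIntegrable_const (c := (1 : ℝ))) fun t _ => (h01 _).2
  simpa [orbitAverage] using this

theorem orbitAverage_flow (φ : Flow ℝ≥0 X) (l : X → ℝ) (s : ℝ≥0) (x : X) :
    orbitAverage φ l (φ s x) = ∫ u in (s : ℝ)..s + 1, l (φ u.toNNReal x) := by
  rw [orbitAverage]
  have := intervalIntegral.integral_comp_add_right (a := 0) (b := 1)
    (fun u : ℝ => l (φ u.toNNReal x)) (s : ℝ)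
  rw [zero_add, add_comm 1] at this
  rw [← this]
  refine intervalIntegral.integral_congr fun t ht => ?_
  rw [uIcc_of_le zero_le_one] at ht
  rw [← φ.map_add, Real.toNNReal_add ht.1 s.coe_nonneg, Real.toNNReal_coe]

/-- The decrease of the orbit average along an orbit is the integral of the decrease of the
function under the time-one map. -/
theorem orbitAverage_flow_sub (φ : Flow ℝ≥0 X) {l : X → ℝ} (hl : Continuous l) (s t : ℝ≥0)
    (x : X) : orbitAverage φ l (φ s x) - orbitAverage φ l (φ t x) =
      (∫ u in (s : ℝ)..t, l (φ u.toNNReal x)) -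
        ∫ u in (s : ℝ)..t, l (φ 1 (φ u.toNNReal x)) := by
  have hc := continuous_comp_flow_toNNReal φ hl x
  have hi := fun a b : ℝ => hc.intervalIntegrable (μ := MeasureTheory.volume) a b
  have hshift : (∫ u in (s : ℝ)..t, l (φ 1 (φ u.toNNReal x))) =
      ∫ u in (s : ℝ) + 1..t + 1, l (φ u.toNNReal x) := by
    rw [← intervalIntegral.integral_comp_add_right (fun u : ℝ => l (φ u.toNNReal x)) (1 : ℝ)]
    refine intervalIntegral.integral_congr fun u hu => ?_
    have hu0 : 0 ≤ u := (le_inf s.2 t.2).trans hu.1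
    rw [← φ.map_add, Real.toNNReal_add hu0 zero_le_one, Real.toNNReal_one, add_comm]
  rw [hshift, orbitAverage_flow, orbitAverage_flow,
    intervalIntegral.integral_interval_sub_interval_comm (hi _ _) (hi _ _) (hi _ _)]

theorem orbitAverage_flow_antitone (φ : Flow ℝ≥0 X) {l : X → ℝ} (hl : Continuous l)
    (hle : ∀ x, l (φ 1 x) ≤ l x) (x : X) : Antitone fun t : ℝ≥0 => orbitAverage φ l (φ t x) := by
  intro s t hst
  rw [← sub_nonneg, orbitAverage_flow_sub φ hl, sub_nonneg]
  exact intervalIntegral.integral_mono (NNReal.coe_le_coe.2 hst)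
    ((continuous_comp_flow_toNNReal φ (hl.comp (φ.continuous_toFun 1)) x).intervalIntegrable _ _)
    ((continuous_comp_flow_toNNReal φ hl x).intervalIntegrable _ _) fun u => hle _

/-- The integrand `l - l ∘ φ 1` along the orbit is continuous and nonnegative, and positive at the
left end point `s`. -/
theorem orbitAverage_flow_lt (φ : Flow ℝ≥0 X) {l : X → ℝ} (hl : Continuous l)
    (hle : ∀ x, l (φ 1 x) ≤ l x) {x : X} {s t : ℝ≥0} (hst : s < t)
    (hlt : l (φ 1 (φ s x)) < l (φ s x)) :
    orbitAverage φ l (φ t x) < orbitAverage φ l (φ s x) := by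
  rw [← sub_pos, orbitAverage_flow_sub φ hl, sub_pos]
  refine intervalIntegral.integral_lt_integral_of_continuousOn_of_le_of_exists_lt
    (NNReal.coe_lt_coe.2 hst)
    (continuous_comp_flow_toNNReal φ (hl.comp (φ.continuous_toFun 1)) x).continuousOn
    (continuous_comp_flow_toNNReal φ hl x).continuousOn (fun u _ => hle _)
    ⟨s, left_mem_Icc.2 (NNReal.coe_le_coe.2 hst.le), ?_⟩
  simpa using hlt

/-- The field `const` covers integer times only. For real `t`, `x` and `φ t x` are chain equivalent
for the semiflow, hence for `φ 1`. -/
theorem IsCompleteLyapunovMap.apply_flow_eq {φ : Flow ℝ≥0 X} {l : X → ℝ}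
    (hl : IsCompleteLyapunovMap (fun x => φ 1 x) l) {x : X}
    (hx : x ∈ chainRecurrentSet (SemiflowChains φ)) (t : ℝ≥0) : l (φ t x) = l x :=
  hl.eq_of_chains ((SemiflowChains.flow_right hx t).mapChains (flow_mem_chainRecurrentSet hx t))
    ((SemiflowChains.flow_left hx t).mapChains hx)

theorem IsCompleteLyapunovMap.orbitAverage_eq {φ : Flow ℝ≥0 X} {l : X → ℝ}
    (hl : IsCompleteLyapunovMap (fun x => φ 1 x) l) {x : X}
    (hx : x ∈ chainRecurrentSet (SemiflowChains φ)) : orbitAverage φ l x = l x := by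
  simp [orbitAverage, hl.apply_flow_eq hx]

theorem IsCompleteLyapunovMap.orbitAverage_flow_lt {φ : Flow ℝ≥0 X} {l : X → ℝ}
    (hl : IsCompleteLyapunovMap (fun x => φ 1 x) l) {x : X} {s t : ℝ≥0} (hst : s < t)
    (hs : φ s x ∉ chainRecurrentSet (SemiflowChains φ)) :
    orbitAverage φ l (φ t x) < orbitAverage φ l (φ s x) :=
  _root_.orbitAverage_flow_lt φ hl.continuous hl.apply_le hst
    (hl.apply_lt (by rwa [← chainRecurrentSet_semiflow_eq]))

theorem IsCompleteLyapunovMap.image_orbitAverage {φ : Flow ℝ≥0 X} {l : X → ℝ}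
    (hl : IsCompleteLyapunovMap (fun x => φ 1 x) l) :
    orbitAverage φ l '' chainRecurrentSet (SemiflowChains φ) =
      l '' chainRecurrentSet (MapChains fun x => φ 1 x) := by
  rw [← chainRecurrentSet_semiflow_eq]
  exact image_congr fun x hx => hl.orbitAverage_eq hx

/-- The orbit average of a complete Lyapunov function of the time-one map is a complete Lyapunov
function of the semiflow. -/
theorem IsCompleteLyapunovMap.isCompleteLyapunovSemiflow {φ : Flow ℝ≥0 X} {l : X → ℝ}
    (hl : IsCompleteLyapunovMap (fun x => φ 1 x) l) :
    IsCompleteLyapunovSemiflow φ (orbitAverage φ l) where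
  continuous := continuous_orbitAverage φ hl.continuous
  mem_Icc := orbitAverage_mem_Icc φ hl.continuous hl.mem_Icc
  const x hx s t := by
    rw [hl.orbitAverage_eq (flow_mem_chainRecurrentSet hx s),
      hl.orbitAverage_eq (flow_mem_chainRecurrentSet hx t), hl.apply_flow_eq hx,
      hl.apply_flow_eq hx]
  antitone x _ := orbitAverage_flow_antitone φ hl.continuous hl.apply_le x
  strict x _ s t hst hs := hl.orbitAverage_flow_lt hst hs
  nowhereDense := by
    rw [hl.image_orbitAverage]
    exact hl.nowhereDense
  level c hc := by
    rw [isChainComponent_semiflow_iff]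
    convert hl.level c (by rwa [← hl.image_orbitAverage]) using 1
    ext x
    rw [← chainRecurrentSet_semiflow_eq]
    refine and_congr_left fun hx => ?_
    rw [mem_preimage, mem_preimage, hl.orbitAverage_eq hx]

/-- Otherwise connectedness keeps `l` along the orbit strictly on one side of its own average. -/
theorem exists_orbitAverage_eq (φ : Flow ℝ≥0 X) {l : X → ℝ} (hl : Continuous l) (x : X) :
    ∃ t : ℝ≥0, l (φ t x) = orbitAverage φ l x := by
  by_contra! hne
  have hc := continuous_comp_flow_toNNReal φ hl x
  have hpre : IsPreconnected (range fun u : ℝ => l (φ u.toNNReal x)) :=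
    isPreconnected_range hc
  have hnot : orbitAverage φ l x ∉ range fun u : ℝ => l (φ u.toNNReal x) := by
    rintro ⟨u, hu⟩
    exact hne _ hu
  have hconst : (∫ _ in (0 : ℝ)..1, orbitAverage φ l x) = orbitAverage φ l x := by simp
  have hside : (∀ u : ℝ, l (φ u.toNNReal x) < orbitAverage φ l x) ∨
      ∀ u : ℝ, orbitAverage φ l x < l (φ u.toNNReal x) := by
    by_contra! h
    obtain ⟨⟨u, hu⟩, v, hv⟩ := h
    exact hnot (hpre.ordConnected.out ⟨v, rfl⟩ ⟨u, rfl⟩ ⟨hv, hu⟩)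
  rcases hside with h | h
  · have := intervalIntegral.integral_lt_integral_of_continuousOn_of_le_of_exists_lt
      (zero_lt_one (α := ℝ)) hc.continuousOn (continuousOn_const (c := orbitAverage φ l x))
      (fun u _ => (h u).le) ⟨0, by simp, h 0⟩
    rw [hconst] at this
    exact lt_irrefl _ this
  · have := intervalIntegral.integral_lt_integral_of_continuousOn_of_le_of_exists_lt
      (zero_lt_one (α := ℝ)) (continuousOn_const (c := orbitAverage φ l x)) hc.continuousOn
      (fun u _ => (h u).le) ⟨0, by simp, h 0⟩
    rw [hconst] at this
    exact lt_irrefl _ this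

/-- The orbit of a point `x` of the level set meets `l ⁻¹' {c}` at some `φ t x`, which is recurrent,
so `L (φ t x) = l (φ t x) = L x`. If `x` were not recurrent, this would contradict strict decrease.
-/
theorem IsCompleteLyapunovMap.isChainComponent_preimage_orbitAverage {φ : Flow ℝ≥0 X} {l : X → ℝ}
    (hl : IsCompleteLyapunovMap (fun x => φ 1 x) l)
    (hlevel : ∀ c ∈ l '' chainRecurrentSet (MapChains fun x => φ 1 x),
      IsChainComponent (MapChains fun x => φ 1 x) (l ⁻¹' {c}))
    {c : ℝ} (hc : c ∈ orbitAverage φ l '' chainRecurrentSet (SemiflowChains φ)) :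
    IsChainComponent (SemiflowChains φ) (orbitAverage φ l ⁻¹' {c}) := by
  have hcomp := hl.isCompleteLyapunovSemiflow.level c hc
  suffices h : orbitAverage φ l ⁻¹' {c} ⊆ chainRecurrentSet (SemiflowChains φ) by
    rwa [inter_eq_left.2 h] at hcomp
  rintro x rfl
  by_contra hx
  obtain ⟨t, ht⟩ := exists_orbitAverage_eq φ hl.continuous x
  rw [hl.image_orbitAverage] at hc
  obtain ⟨z, -, hz⟩ := hlevel _ hc
  have hmem : φ t x ∈ l ⁻¹' {orbitAverage φ l x} := ht
  rw [hz] at hmem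
  have hrec : φ t x ∈ chainRecurrentSet (SemiflowChains φ) := by
    rw [chainRecurrentSet_semiflow_eq]
    exact hmem.1
  have ht0 : 0 < t := by
    refine pos_iff_ne_zero.2 fun h0 => hx ?_
    rwa [h0, φ.map_zero_apply] at hrec
  have hlt := hl.orbitAverage_flow_lt ht0 (by rwa [φ.map_zero_apply] : φ 0 x ∉ _)
  rw [hl.orbitAverage_eq hrec, ht, φ.map_zero_apply] at hlt
  exact lt_irrefl _ hlt

/-- Under `hanti` the orbit never enters the recurrent set: `l` would be constant from then on, also
at integer times. -/
theorem IsCompleteLyapunovMap.orbitAverage_strictAnti {φ : Flow ℝ≥0 X} {l : X → ℝ}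
    (hl : IsCompleteLyapunovMap (fun x => φ 1 x) l)
    (hanti : ∀ x ∉ chainRecurrentSet (MapChains fun x => φ 1 x),
      StrictAnti fun n : ℕ => l ((fun x => φ 1 x)^[n] x))
    {x : X} (hx : x ∉ chainRecurrentSet (SemiflowChains φ)) :
    StrictAnti fun t : ℝ≥0 => orbitAverage φ l (φ t x) := by
  intro s t hst
  refine hl.orbitAverage_flow_lt hst fun hs => ?_
  obtain ⟨n, hn⟩ := exists_nat_ge s
  have hlt := hanti x (by rwa [← chainRecurrentSet_semiflow_eq]) n.lt_succ_self
  simp only [flow_one_iterate] at hlt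
  have hconst : ∀ u, s ≤ u → l (φ u x) = l (φ s x) := fun u hu => by
    rw [← tsub_add_cancel_of_le hu, φ.map_add, hl.apply_flow_eq hs]
  rw [hconst _ hn, hconst _ (hn.trans (by simp))] at hlt
  exact lt_irrefl _ hlt

end OrbitAverage

/-! ### Existence of complete Lyapunov functions -/

section Existence

variable {X : Type*} [MetricSpace X]

/-- Lyapunov functions of a map with values `0` and `1` on the chain recurrent set that are
constant on the chain transitive components. -/
structure IsBinaryLyapunov (T : X → X) (k : X → ℝ) : Prop where
  continuous : Continuous k
  mem_Icc : ∀ x, k x ∈ Icc (0 : ℝ) 1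
  apply_le : ∀ x, k (T x) ≤ k x
  eq_zero_or_one : ∀ x, MapChains T x x → k x = 0 ∨ k x = 1
  eq_of_chains : ∀ x y, MapChains T x y → MapChains T y x → k x = k y

theorem isBinaryLyapunov_zero (T : X → X) : IsBinaryLyapunov T fun _ => 0 :=
  ⟨continuous_const, fun _ => by simp, fun _ => le_rfl, fun _ _ => .inl rfl, fun _ _ _ _ => rfl⟩

/-- The set of points reached from `x` by `ε`-chains is attracting, and a Urysohn function of the
closure of its image and its complement is a Lyapunov function. -/
theorem exists_isBinaryLyapunov {T : X → X} {ε : X → ℝ} (hε : Continuous ε)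
    (hpos : ∀ z, 0 < ε z) {x y : X}
    (hxy : ¬ TransGen (fun u v => dist (T u) v < ε (T u)) x y) :
    ∃ k, IsBinaryLyapunov T k ∧ k y = 1 ∧
      ∀ z, TransGen (fun u v => dist (T u) v < ε (T u)) x z → k z < 1 := by
  set r : X → X → Prop := fun u v => dist (T u) v < ε (T u) with hr
  set U : Set X := {z | TransGen r x z} with hU
  have hTx : T x ∈ U := .single (by simpa [hr] using hpos _)
  have hTU : (T '' U).Nonempty := ⟨_, _, hTx, rfl⟩
  have hUc : Uᶜ.Nonempty := ⟨y, hxy⟩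
  have hopen : IsOpen U := by
    refine isOpen_iff_mem_nhds.2 fun z hz => ?_
    obtain ⟨w, hxw, hwz⟩ := TransGen.tail'_iff.1 hz
    have : ∀ᶠ z' in 𝓝 z, dist (T w) z' < ε (T w) :=
      (continuous_const.dist continuous_id).continuousAt.eventually (gt_mem_nhds hwz)
    exact this.mono fun z' h => TransGen.tail' hxw h
  have hclosure : closure (T '' U) ⊆ U := by
    intro z hz
    -- The tolerance is evaluated at the image point `p = T u`, so continuity of `ε` lets a jump
    -- from a nearby image land on `z`.
    have hev : ∀ᶠ p in 𝓝 z, dist p z < ε p := by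
      have hc : ContinuousAt (fun p => ε p - dist p z) z := by fun_prop
      have := hc.eventually (lt_mem_nhds (show 0 < ε z - dist z z by simpa using hpos z))
      exact this.mono fun p hp => sub_pos.1 hp
    obtain ⟨-, hp, u, hu, rfl⟩ := mem_closure_iff_nhds.1 hz _ hev
    exact TransGen.tail hu hp
  have hA : ∀ z, 0 ≤ Metric.infDist z (T '' U) := fun z => Metric.infDist_nonneg
  have hB : ∀ z, 0 ≤ Metric.infDist z Uᶜ := fun z => Metric.infDist_nonneg
  have hBpos : ∀ z ∈ U, 0 < Metric.infDist z Uᶜ := fun z hz =>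
    (hopen.isClosed_compl.notMem_iff_infDist_pos hUc).1 (not_not.2 hz)
  have hBzero : ∀ z ∉ U, Metric.infDist z Uᶜ = 0 := fun z hz => Metric.infDist_zero_of_mem hz
  have hApos : ∀ z ∉ U, 0 < Metric.infDist z (T '' U) := fun z hz => by
    have := (isClosed_closure.notMem_iff_infDist_pos hTU.closure).1 fun h => hz (hclosure h)
    rwa [Metric.infDist_closure] at this
  have hsum : ∀ z, 0 < Metric.infDist z (T '' U) + Metric.infDist z Uᶜ := fun z => by
    by_cases hz : z ∈ U
    · linarith [hBpos z hz, hA z]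
    · linarith [hApos z hz, hB z]
  set k : X → ℝ := fun z =>
    Metric.infDist z (T '' U) / (Metric.infDist z (T '' U) + Metric.infDist z Uᶜ) with hk
  have hk_one : ∀ z ∉ U, k z = 1 := fun z hz => by
    simp only [hk, hBzero z hz, add_zero]
    exact div_self (hApos z hz).ne'
  have hk_lt : ∀ z ∈ U, k z < 1 := fun z hz => by
    rw [hk, div_lt_one (hsum z)]
    linarith [hBpos z hz]
  have hk_zero : ∀ z ∈ closure (T '' U), k z = 0 := fun z hz => by
    have := Metric.infDist_zero_of_mem hz
    rw [Metric.infDist_closure] at this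
    simp [hk, this]
  have hk_mem : ∀ z, k z ∈ Icc (0 : ℝ) 1 := fun z =>
    ⟨div_nonneg (hA z) (hsum z).le, (div_le_one (hsum z)).2 (by linarith [hB z])⟩
  -- The last jump of a chain from `z` to itself starts at some `w ∈ U`, with `T w` within `δ` of
  -- `z`.
  have hrec : ∀ z ∈ U, MapChains T z z → z ∈ closure (T '' U) := by
    intro z hz hzz
    refine Metric.mem_closure_iff.2 fun δ hδ => ?_
    obtain ⟨w, hzw, hwz⟩ := TransGen.tail'_iff.1 <|
      hzz (fun p => min (ε p) δ) (hε.min continuous_const) fun p => lt_min (hpos p) hδ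
    refine ⟨T w, ⟨w, ?_, rfl⟩, ?_⟩
    · exact hz.trans_left
        (ReflTransGen.mono (fun u v huv => huv.trans_le (min_le_left _ _)) _ _ hzw)
    · rw [dist_comm]
      exact hwz.trans_le (min_le_right _ _)
  have hbin : ∀ z, MapChains T z z → k z = 0 ∨ k z = 1 := fun z hz => by
    by_cases hzU : z ∈ U
    · exact .inl (hk_zero z (hrec z hzU hz))
    · exact .inr (hk_one z hzU)
  refine ⟨k, ⟨?_, hk_mem, fun z => ?_, hbin, fun p q hpq hqp => ?_⟩, hk_one y hxy, hk_lt⟩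
  · exact (Metric.continuous_infDist_pt _).div
      ((Metric.continuous_infDist_pt _).add (Metric.continuous_infDist_pt _))
      fun z => (hsum z).ne'
  · by_cases hz : z ∈ U
    · rw [hk_zero _ (subset_closure ⟨z, hz, rfl⟩)]
      exact (hk_mem z).1
    · rw [hk_one z hz]
      exact (hk_mem _).2
  · by_cases hp : p ∈ U
    · have hq : q ∈ U := hp.trans (hpq ε hε hpos)
      rw [hk_zero _ (hrec p hp (hpq.trans hqp)), hk_zero _ (hrec q hq (hqp.trans hpq))]
    · have hq : q ∉ U := fun hq => hp (hq.trans (hqp ε hε hpos))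
      rw [hk_one p hp, hk_one q hq]

/-- In a separable space countably many binary Lyapunov functions suffice. -/
theorem exists_seq_isBinaryLyapunov [SecondCountableTopology X] {T : X → X} (hT : Continuous T) :
    ∃ k : ℕ → X → ℝ, (∀ n, IsBinaryLyapunov T (k n)) ∧
      (∀ x, ¬ MapChains T x x → ∃ n, k n (T x) < k n x) ∧
      ∀ x y, MapChains T x x → MapChains T y y → (∀ n, k n x = k n y) → MapChains T x y := by
  let ι := {k : X → ℝ // IsBinaryLyapunov T k}
  -- Lindelöf twice: `A` detects strict decrease at non-recurrent points, `B` separates recurrent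
  -- points in different components.
  obtain ⟨A, hA, hAU⟩ := TopologicalSpace.isOpen_iUnion_countable
    (fun i : ι => {x | i.1 (T x) < i.1 x})
    fun i => isOpen_lt (i.2.continuous.comp hT) i.2.continuous
  obtain ⟨B, hB, hBU⟩ := TopologicalSpace.isOpen_iUnion_countable
    (fun i : ι => {p : X × X | i.1 p.1 < i.1 p.2})
    fun i => isOpen_lt (i.2.continuous.comp continuous_fst) (i.2.continuous.comp continuous_snd)
  obtain ⟨f, hf⟩ := ((hA.union hB).insert (⟨_, isBinaryLyapunov_zero T⟩ : ι)).exists_eq_range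
    (insert_nonempty _ _)
  refine ⟨fun n => (f n).1, fun n => (f n).2, fun x hx => ?_, fun x y hx hy hxy => ?_⟩
  · simp only [MapChains, not_forall] at hx
    obtain ⟨ε, hε, hpos, hx⟩ := hx
    obtain ⟨k, hk, h1, hlt⟩ := exists_isBinaryLyapunov hε hpos hx
    have hmem : x ∈ ⋃ i : ι, {x | i.1 (T x) < i.1 x} := by
      refine mem_iUnion.2 ⟨⟨k, hk⟩, ?_⟩
      change k (T x) < k x
      rw [h1]
      exact hlt _ (.single (by simpa using hpos (T x)))
    rw [← hAU] at hmem
    obtain ⟨i, hi, hxi⟩ := mem_iUnion₂.1 hmem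
    obtain ⟨n, rfl⟩ : i ∈ range f := hf ▸ mem_insert_of_mem _ (.inl hi)
    exact ⟨n, hxi⟩
  · by_contra hnot
    simp only [MapChains, not_forall] at hnot
    obtain ⟨ε, hε, hpos, hnot⟩ := hnot
    obtain ⟨k, hk, h1, hlt⟩ := exists_isBinaryLyapunov hε hpos hnot
    have hmem : (x, y) ∈ ⋃ i : ι, {p : X × X | i.1 p.1 < i.1 p.2} := by
      refine mem_iUnion.2 ⟨⟨k, hk⟩, ?_⟩
      change k x < k y
      rw [h1]
      -- `x` is recurrent, hence reached from itself, while `y` is not reached from `x`.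
      exact hlt _ (hx ε hε hpos)
    rw [← hBU] at hmem
    obtain ⟨i, hi, hxi⟩ := mem_iUnion₂.1 hmem
    obtain ⟨n, rfl⟩ : i ∈ range f := hf ▸ mem_insert_of_mem _ (.inr hi)
    exact hxi.ne (hxy n)

theorem continuous_cantorFunction {c : ℝ} (h0 : 0 ≤ c) (h1 : c < 1) :
    Continuous (Cardinal.cantorFunction c) := by
  refine continuous_tsum (u := fun n => c ^ n) (fun n => ?_)
    (summable_geometric_of_lt_one h0 h1) fun n f => ?_
  · exact (continuous_of_discreteTopology (f := fun b : Bool => cond b (c ^ n) 0)).comp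
      (continuous_apply n)
  · rw [Real.norm_of_nonneg (Cardinal.cantorFunctionAux_nonneg h0)]
    cases h : f n
    · rw [Cardinal.cantorFunctionAux_false h]
      positivity
    · rw [Cardinal.cantorFunctionAux_true h]

/-- A continuous injective image of the Cantor space is nowhere dense in the unit interval. -/
theorem isNowhereDense_of_subset_range {g : (ℕ → Bool) → ℝ} (hg : Continuous g)
    (hinj : Function.Injective g) {S : Set (Icc (0 : ℝ) 1)}
    (hS : ∀ c ∈ S, (c : ℝ) ∈ range g) : IsNowhereDense S := by
  have hclosed : IsClosed (((↑) : Icc (0 : ℝ) 1 → ℝ) ⁻¹' range g) :=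
    (isCompact_range hg).isClosed.preimage continuous_subtype_val
  have htd : IsTotallyDisconnected (range g) :=
    (hg.isClosedEmbedding hinj).isEmbedding.isTotallyDisconnected_range.2 inferInstance
  have hsub : closure S ⊆ ((↑) : Icc (0 : ℝ) 1 → ℝ) ⁻¹' range g :=
    hclosed.closure_subset_iff.2 hS
  refine eq_empty_of_forall_notMem fun x hx => ?_
  -- An interior point would put a nondegenerate segment into a totally disconnected set.
  obtain ⟨a, b, hab, h⟩ := isOpen_interior.exists_Ioo_subset ⟨x, hx⟩
  obtain ⟨c, hac, hcb⟩ := exists_between hab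
  obtain ⟨d, hcd, hdb⟩ := exists_between hcb
  have hIcc : Icc (c : ℝ) d ⊆ range g := fun r hr =>
    hsub (interior_subset (h (show (⟨r, c.2.1.trans hr.1, hr.2.trans d.2.2⟩ : Icc (0 : ℝ) 1) ∈
      Ioo a b from ⟨hac.trans_le hr.1, lt_of_le_of_lt (show _ ≤ d from hr.2) hdb⟩)))
  have hcd' : (c : ℝ) < d := hcd
  exact hcd'.ne (htd _ hIcc isPreconnected_Icc (left_mem_Icc.2 hcd'.le) (right_mem_Icc.2 hcd'.le))

/-- Every continuous map of a separable metric space has a complete Lyapunov function. -/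
theorem exists_isCompleteLyapunovMap [SecondCountableTopology X] {T : X → X}
    (hT : Continuous T) : ∃ l, IsCompleteLyapunovMap T l := by
  obtain ⟨k, hk, hstrict, hsep⟩ := exists_seq_isBinaryLyapunov hT
  have hgeom : Summable fun n : ℕ => (1 / 3 : ℝ) ^ n :=
    summable_geometric_of_lt_one (by norm_num) (by norm_num)
  have hnonneg : ∀ x n, 0 ≤ (1 / 3 : ℝ) ^ n * k n x := fun x n =>
    mul_nonneg (by positivity) ((hk n).mem_Icc x).1
  have hle : ∀ x n, (1 / 3 : ℝ) ^ n * k n x ≤ (1 / 3) ^ n := fun x n =>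
    mul_le_of_le_one_right (by positivity) ((hk n).mem_Icc x).2
  have hsummable : ∀ x, Summable fun n : ℕ => (1 / 3 : ℝ) ^ n * k n x := fun x =>
    .of_nonneg_of_le (hnonneg x) (hle x) hgeom
  -- A ratio below `1/2` makes the Cantor function injective; `2/3` normalises the sum `3/2` of the
  -- weights.
  set l : X → ℝ := fun x => 2 / 3 * ∑' n : ℕ, (1 / 3 : ℝ) ^ n * k n x with hl
  set g : (ℕ → Bool) → ℝ := fun f => 2 / 3 * Cardinal.cantorFunction (1 / 3) f with hgdef
  have hg : Continuous g :=
    continuous_const.mul (continuous_cantorFunction (by norm_num) (by norm_num))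
  have hginj : Function.Injective g := fun f f' h =>
    Cardinal.cantorFunction_injective (c := 1 / 3) (by norm_num) (by norm_num)
      (mul_left_cancel₀ (by norm_num : (2 / 3 : ℝ) ≠ 0) h)
  have hlg : ∀ x, MapChains T x x → l x = g fun n => decide (k n x = 1) := by
    intro x hx
    simp only [hl, hgdef, Cardinal.cantorFunction]
    congr 2
    funext n
    rcases (hk n).eq_zero_or_one x hx with h | h <;> simp [Cardinal.cantorFunctionAux, h]
  have happly_le : ∀ x, l (T x) ≤ l x := fun x =>
    mul_le_mul_of_nonneg_left ((hsummable _).tsum_le_tsum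
      (fun n => mul_le_mul_of_nonneg_left ((hk n).apply_le x) (by positivity)) (hsummable _))
      (by norm_num)
  have happly_lt : ∀ x, ¬ MapChains T x x → l (T x) < l x := fun x hx => by
    obtain ⟨n, hn⟩ := hstrict x hx
    exact mul_lt_mul_of_pos_left ((hsummable _).tsum_lt_tsum
      (fun n => mul_le_mul_of_nonneg_left ((hk n).apply_le x) (by positivity))
      (mul_lt_mul_of_pos_left hn (by positivity)) (hsummable _)) (by norm_num)
  have hanti : ∀ x, Antitone fun n : ℕ => l (T^[n] x) := fun x =>
    antitone_nat_of_succ_le fun n => by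
      rw [Function.iterate_succ_apply']
      exact happly_le _
  have heq : ∀ x y, MapChains T x y → MapChains T y x → l x = l y := fun x y hxy hyx => by
    simp only [hl]
    congr 2
    funext n
    rw [(hk n).eq_of_chains x y hxy hyx]
  -- On recurrent points the `k n` are the digits of `l`, so equal values of `l` force equal digits.
  have hkeq : ∀ x y, MapChains T x x → MapChains T y y → l x = l y → ∀ n, k n x = k n y := by
    intro x y hx hy hxy n
    rw [hlg x hx, hlg y hy] at hxy
    have hn := congrFun (hginj hxy) n
    rw [decide_eq_decide] at hn
    rcases (hk n).eq_zero_or_one x hx with h | h <;>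
      rcases (hk n).eq_zero_or_one y hy with h' | h' <;> simp_all
  have hconst : ∀ n x, MapChains T x x → MapChains T (T^[n] x) (T^[n] x) ∧
      l (T^[n] x) = l x := by
    intro n x hx
    induction n with
    | zero => exact ⟨hx, rfl⟩
    | succ n ih =>
      rw [Function.iterate_succ_apply']
      have h := MapChains.apply_left hT ih.1
      exact ⟨h.trans (.apply_right _), (heq _ _ h (.apply_right _)).trans ih.2⟩
  refine ⟨l, ⟨?_, fun x => ?_, fun x hx s t => ?_, fun x _ => hanti x, fun x _ s t hst hs => ?_,
    ?_, ?_⟩⟩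
  · refine continuous_const.mul (continuous_tsum
      (fun n => continuous_const.mul (hk n).continuous) hgeom fun n x => ?_)
    rw [Real.norm_of_nonneg (hnonneg x n)]
    exact hle x n
  · have h0 : 0 ≤ ∑' n : ℕ, (1 / 3 : ℝ) ^ n * k n x := tsum_nonneg (hnonneg x)
    have h1 := (hsummable x).tsum_le_tsum (hle x) hgeom
    rw [tsum_geometric_of_lt_one (by norm_num) (by norm_num)] at h1
    refine ⟨mul_nonneg (by norm_num) h0, ?_⟩
    calc l x ≤ 2 / 3 * (1 - 1 / 3)⁻¹ := mul_le_mul_of_nonneg_left h1 (by norm_num)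
      _ = 1 := by norm_num
  · exact (hconst s x hx).2.trans (hconst t x hx).2.symm
  · refine (hanti x (Nat.succ_le_of_lt hst)).trans_lt ?_
    simp only [Function.iterate_succ_apply']
    exact happly_lt _ hs
  · refine isNowhereDense_of_subset_range hg hginj ?_
    rintro c ⟨x, hx, hxc⟩
    exact ⟨_, (hlg x hx).symm.trans hxc⟩
  · rintro _ ⟨x, hx, rfl⟩
    refine ⟨x, hx, Set.ext fun y => ⟨fun ⟨hxy, hy⟩ => ⟨hy, ?_, ?_⟩, fun ⟨hy, hxy, hyx⟩ =>
      ⟨heq y x hyx hxy, hy⟩⟩⟩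
    · exact hsep x y hx hy fun n => (hkeq y x hy hx hxy n).symm
    · exact hsep y x hy hx (hkeq y x hy hx hxy)

end Existence

theorem theorem1p1 {X : Type*} [MetricSpace X] (φ : Flow ℝ≥0 X) :
    (∀ l : X → ℝ, IsCompleteLyapunovMap (fun x => φ 1 x) l →
      IsCompleteLyapunovSemiflow φ (orbitAverage φ l) ∧
      -- if the whole level sets of `l` are chain transitive components, so are those of `L`
      ((∀ c ∈ l '' chainRecurrentSet (MapChains fun x => φ 1 x),
          IsChainComponent (MapChains fun x => φ 1 x) (l ⁻¹' {c})) →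
        ∀ c ∈ orbitAverage φ l '' chainRecurrentSet (SemiflowChains φ),
          IsChainComponent (SemiflowChains φ) (orbitAverage φ l ⁻¹' {c})) ∧
      -- if `l` decreases strictly along whole orbits starting off the chain recurrent set,
      -- so does `L`
      ((∀ x ∉ chainRecurrentSet (MapChains fun x => φ 1 x),
          StrictAnti fun n : ℕ => l ((fun x => φ 1 x)^[n] x)) →
        ∀ x ∉ chainRecurrentSet (SemiflowChains φ),
          StrictAnti fun t : ℝ≥0 => orbitAverage φ l (φ t x))) ∧
    (TopologicalSpace.SeparableSpace X → ∃ L : X → ℝ, IsCompleteLyapunovSemiflow φ L) := by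
  refine ⟨fun l hl => ⟨hl.isCompleteLyapunovSemiflow,
    fun hlevel c hc => hl.isChainComponent_preimage_orbitAverage hlevel hc,
    fun hanti x hx => hl.orbitAverage_strictAnti hanti hx⟩, fun _ => ?_⟩
  have := UniformSpace.secondCountable_of_separable X
  obtain ⟨l, hl⟩ := exists_isCompleteLyapunovMap (φ.continuous_toFun 1)
  exact ⟨_, hl.isCompleteLyapunovSemiflow⟩
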